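/- Let $A_1,\dots,A_m$ be complex $n\times n$ matrices, let $Q$ be a (Hermitian) positive definite $n\times n$ matrix, and let $X$ be a positive definite solution of $$X-\sum_{i=1}^m A_i^*X^{-1}A_i=Q .$$ Let $\|\cdot\|$ be the spectral norm and $\mathcal H^{n\times n}$ the real space of Hermitian $n\times n$ matrices. Put $B_i=X^{-1}A_i$ and define $\mathbf L:\mathcal H^{n\times n}\to\mathcal H^{n\times n}$ by $\mathbf LW=W+\sum_{i=1}^m B_i^*WB_i$. Then $\mathbf L$ is invertible. Let $\mathbf P_iZ=\mathbf L^{-1}(B_i^*Z+Z^*B_i)$ for $Z\in\mathbb C^{n\times n}$, let $\|\mathbf L^{-1}\|$ and $\|\mathbf P_i\|$ be the operator norms induced by the spectral norm, and set $$l=\|\mathbf L^{-1}\|^{-1},\quad \zeta=\|X^{-1}\|,\quad \theta=\sum_{i=1}^m\|B_i\|^2 .$$ (a) Let $\Delta A_i\in\mathbb C^{n\times n}$ and $\Delta Q\in\mathcal H^{n\times n}$ be such that $\widetilde Q=Q+\Delta Q$ is positive definite, let $\widetilde A_i=A_i+\Delta A_i$, and let $\widetilde X$ be a positive definite solution of $\widetilde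 X-\sum_{i=1}^m\widetilde A_i^*\widetilde X^{-1}\widetilde A_i=\widetilde Q$. Put $$\epsilon=\frac1l\|\Delta Q\|+\sum_{i=1}^m\Big(\|\mathbf P_i\|\,\|\Delta A_i\|+\frac{\zeta}{l}\|\Delta A_i\|^2\Big),\qquad \sigma=\frac{\zeta}{l}\sum_{i=1}^m\big((\|A_i\|+\|\Delta A_i\|)\zeta+\|B_i\|\big)\|\Delta A_i\| .$$ If $$\sigma<1\quad\text{and}\quad \epsilon<\frac{l(1-\sigma)^2}{\zeta\big(l+l\sigma+2\theta+2\sqrt{(l\sigma+\theta)(\theta+l)}\big)},$$ then $$\|\widetilde X-X\|\le \xi_3:=\frac{2l\epsilon}{l(1+\zeta\epsilon-\sigma)+\sqrt{l^2(1+\zeta\epsilon-\sigma)^2-4l\zeta\epsilon(l+\theta)}},$$ and $\xi_3$ is the smallest real root of $\zeta(l+\theta)\xi^2-l(1+\zeta\epsilon-\sigma)\xi+l\epsilon=0$. (b) As $(\Delta A_1,\dots,\Delta A_m,\Delta Q)\to0$ with $\Delta A_i\in\mathbb C^{n\times n}$, $\Delta Q\in\mathcal H^{n\times n}$, the positive definite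 solution $\widetilde X$ of the perturbed equation satisfies $$\|\widetilde X-X\|\le\frac1l\|\Delta Q\|+\sum_{i=1}^m\|\mathbf P_i\|\,\|\Delta A_i\|+O\big(\|(\Delta A_1,\dots,\Delta A_m,\Delta Q)\|_F^2\big)$$ and $$\widetilde X-X=\mathbf L^{-1}\Delta Q+\mathbf L^{-1}\sum_{i=1}^m(B_i^*\Delta A_i+\Delta A_i^*B_i)+O\big(\|(\Delta A_1,\dots,\Delta A_m,\Delta Q)\|_F^2\big),$$ where $\|\cdot\|_F$ is the Frobenius norm and the constants in $O(\cdot)$ depend only on $A_1,\dots,A_m,Q,X$. -/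

import Mathlib

open scoped Matrix.Norms.L2Operator ComplexOrder Matrix

noncomputable section

namespace MatrixEq

/-- Complex `n × n` matrices; `‖·‖` on them is the spectral norm. -/
abbrev Mat (n : ℕ) : Type := Matrix (Fin n) (Fin n) ℂ

/-- The real normed space of Hermitian `n × n` matrices, with the spectral norm. -/
abbrev Herm (n : ℕ) : Type := selfAdjoint.submodule ℝ (Mat n)

/-- `X` is a positive definite solution of `X - ∑ Aᵢ* X⁻¹ Aᵢ = Q`. -/
def IsPosDefSolution {m n : ℕ} (A : Fin m → Mat n) (Q X : Mat n) : Prop :=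
  X.PosDef ∧ X - ∑ i, (A i)ᴴ * X⁻¹ * A i = Q

/-- `Bᵢ = X⁻¹ Aᵢ`. -/
def B {m n : ℕ} (A : Fin m → Mat n) (X : Mat n) (i : Fin m) : Mat n := X⁻¹ * A i

/-- The operator `L W = W + ∑ Bᵢ* W Bᵢ` on Hermitian matrices. -/
def L {m n : ℕ} (A : Fin m → Mat n) (X : Mat n) : Herm n →L[ℝ] Herm n :=
  LinearMap.toContinuousLinearMap
    { toFun := fun W => ⟨(W : Mat n) + ∑ i, (B A X i)ᴴ * (W : Mat n) * B A X i, by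
        have hW : (W : Mat n)ᴴ = W := W.2
        change _ᴴ = _
        simp [Matrix.conjTranspose_sum, Matrix.conjTranspose_mul, hW, Matrix.mul_assoc]⟩
      map_add' := fun V W => by
        apply Subtype.ext
        simp only [Submodule.coe_add, mul_add, add_mul, Finset.sum_add_distrib]
        abel
      map_smul' := fun c W => by
        apply Subtype.ext
        simp [Finset.smul_sum] }

/-- The inverse of `L`, as an operator on Hermitian matrices (that `L` is invertible is part of the
theorem). -/
def Linv {m n : ℕ} (A : Fin m → Mat n) (X : Mat n) : Herm n →L[ℝ] Herm n :=
  (L A X).inverse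

/-- The real-linear map `Z ↦ Bᵢ* Z + Z* Bᵢ` from complex matrices to Hermitian matrices. -/
def S {m n : ℕ} (A : Fin m → Mat n) (X : Mat n) (i : Fin m) : Mat n →L[ℝ] Herm n :=
  LinearMap.toContinuousLinearMap
    { toFun := fun Z => ⟨(B A X i)ᴴ * Z + Zᴴ * B A X i, by
        change _ᴴ = _
        simp [Matrix.conjTranspose_mul, add_comm]⟩
      map_add' := fun V W => by
        apply Subtype.ext
        simp only [Submodule.coe_add, mul_add, add_mul, Matrix.conjTranspose_add]
        abel
      map_smul' := fun c W => by
        apply Subtype.ext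
        simp [Matrix.conjTranspose_smul] }

/-- `Pᵢ Z = L⁻¹ (Bᵢ* Z + Z* Bᵢ)`. -/
def P {m n : ℕ} (A : Fin m → Mat n) (X : Mat n) (i : Fin m) : Mat n →L[ℝ] Herm n :=
  (Linv A X).comp (S A X i)

/-- `l = ‖L⁻¹‖⁻¹`, with the operator norm induced by the spectral norm. -/
def ell {m n : ℕ} (A : Fin m → Mat n) (X : Mat n) : ℝ := ‖Linv A X‖⁻¹

/-- `ζ = ‖X⁻¹‖`. -/
def zeta {n : ℕ} (X : Mat n) : ℝ := ‖X⁻¹‖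

/-- `θ = ∑ ‖Bᵢ‖²`. -/
def theta {m n : ℕ} (A : Fin m → Mat n) (X : Mat n) : ℝ := ∑ i, ‖B A X i‖ ^ 2

/-- `ε = ‖ΔQ‖ / l + ∑ (‖Pᵢ‖ ‖ΔAᵢ‖ + (ζ / l) ‖ΔAᵢ‖²)`. -/
def eps {m n : ℕ} (A : Fin m → Mat n) (X : Mat n) (ΔA : Fin m → Mat n) (ΔQ : Herm n) : ℝ :=
  1 / ell A X * ‖ΔQ‖ +
    ∑ i, (‖P A X i‖ * ‖ΔA i‖ + zeta X / ell A X * ‖ΔA i‖ ^ 2)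

/-- `σ = (ζ / l) ∑ ((‖Aᵢ‖ + ‖ΔAᵢ‖) ζ + ‖Bᵢ‖) ‖ΔAᵢ‖`. -/
def sigma {m n : ℕ} (A : Fin m → Mat n) (X : Mat n) (ΔA : Fin m → Mat n) : ℝ :=
  zeta X / ell A X * ∑ i, ((‖A i‖ + ‖ΔA i‖) * zeta X + ‖B A X i‖) * ‖ΔA i‖

/-- The bound `ξ₃`, as a function of `l, ζ, θ, σ, ε`. -/
def xi3 (l ζ θ σ ε : ℝ) : ℝ :=
  2 * l * ε /
    (l * (1 + ζ * ε - σ) + √(l ^ 2 * (1 + ζ * ε - σ) ^ 2 - 4 * l * ζ * ε * (l + θ)))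

/-- The Frobenius norm of the block matrix `(ΔA₁, …, ΔAₘ, ΔQ)`. -/
def pertNorm {m n : ℕ} (ΔA : Fin m → Mat n) (ΔQ : Herm n) : ℝ :=
  √((∑ k, ∑ i, ∑ j, ‖ΔA k i j‖ ^ 2) + ∑ i, ∑ j, ‖(ΔQ : Mat n) i j‖ ^ 2)

end MatrixEq

end

/-! In terms of `B`, a positive definite solution satisfies `X - ∑ Bᵢ* X Bᵢ = Q > 0`, so the family
`Bᵢ` is strictly contractive for the form `X`. A maximum argument (`eq_zero_of_stein`) then shows
that `W + ∑ Cᵢ* W Dᵢ = 0` forces `W = 0` for any two such families. This gives both the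
invertibility of `L` and the uniqueness of the positive definite solution.

The perturbed equation for `X + H` is equivalent to the fixed point equation `H = L⁻¹(ΔQ + ∑ Sᵢ ΔAᵢ
+ remainder H)`. On the closed ball of radius `ξ₃` the map sends the ball to itself because `ξ₃` is
a root of the quadratic, and it is a contraction because `ξ₃` is strictly the smaller root. Banach's
theorem yields a positive definite solution `X + H` with `‖H‖ ≤ ξ₃`, and uniqueness identifies it
with the given one (`perturbation_bound`).

For small perturbations of size `p`, this bound gives `‖H‖ = O(p)`. Substituted into the remainder,
it gives an error `O(p²)` (`firstOrder_expansion`). -/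

noncomputable section

namespace MatrixEq

/-! ### Generalized Stein equations: uniqueness of solutions and invertibility of `L` -/

section Uniqueness

open Matrix

/-- The real part of the sesquilinear form `u* M v`. -/
def reForm {n : ℕ} (M : Mat n) (u v : Fin n → ℂ) : ℝ := (star u ⬝ᵥ M *ᵥ v).re

variable {m n : ℕ}

lemma continuous_reForm (M : Mat n) {α : Type*} [TopologicalSpace α] {f g : α → Fin n → ℂ}
    (hf : Continuous f) (hg : Continuous g) : Continuous fun x => reForm M (f x) (g x) := by
  unfold reForm
  exact Complex.continuous_re.comp
    ((hf.star).dotProduct (continuous_const.matrix_mulVec hg))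

lemma reForm_smul (M : Mat n) (c : ℝ) (u v : Fin n → ℂ) :
    reForm M (c • u) (c • v) = c ^ 2 * reForm M u v := by
  unfold reForm
  rw [star_smul, mulVec_smul, smul_dotProduct, dotProduct_smul]
  simp [pow_two, mul_assoc]

lemma reForm_neg_right (M : Mat n) (u v : Fin n → ℂ) : reForm M u (-v) = -reForm M u v := by
  simp [reForm, mulVec_neg]

lemma reForm_add (M N : Mat n) (u v : Fin n → ℂ) :
    reForm (M + N) u v = reForm M u v + reForm N u v := by
  simp [reForm, add_mulVec]

lemma reForm_sub (M N : Mat n) (u v : Fin n → ℂ) :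
    reForm (M - N) u v = reForm M u v - reForm N u v := by
  simp [reForm, sub_mulVec]

lemma reForm_sum (M : Fin m → Mat n) (u v : Fin n → ℂ) :
    reForm (∑ i, M i) u v = ∑ i, reForm (M i) u v := by
  simp [reForm, Matrix.sum_mulVec, dotProduct_sum]

lemma reForm_conj (C M D : Mat n) (u v : Fin n → ℂ) :
    reForm (Cᴴ * M * D) u v = reForm M (C *ᵥ u) (D *ᵥ v) := by
  simp only [reForm]
  rw [← mulVec_mulVec, ← mulVec_mulVec, dotProduct_mulVec, ← star_mulVec]

lemma reForm_self_pos {M : Mat n} (hM : M.PosDef) {u : Fin n → ℂ} (hu : u ≠ 0) :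
    0 < reForm M u u :=
  (Complex.lt_def.1 (hM.dotProduct_mulVec_pos hu)).1

lemma reForm_self_nonneg {M : Mat n} (hM : M.PosDef) (u : Fin n → ℂ) : 0 ≤ reForm M u u := by
  by_cases hu : u = 0
  · simp [hu, reForm]
  · exact (reForm_self_pos hM hu).le

lemma reForm_add_pos {X Y : Mat n} (hX : X.PosDef) (hY : Y.PosDef)
    {p : (Fin n → ℂ) × (Fin n → ℂ)} (hp : p ≠ 0) :
    0 < reForm X p.1 p.1 + reForm Y p.2 p.2 := by
  by_cases h1 : p.1 = 0
  · have h2 : p.2 ≠ 0 := fun h2 => hp (Prod.ext h1 h2)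
    linarith [reForm_self_nonneg hX p.1, reForm_self_pos hY h2]
  · linarith [reForm_self_pos hX h1, reForm_self_nonneg hY p.2]

/-- A generalized Stein equation `W + ∑ Cᵢ* W Dᵢ = 0` has only the trivial solution when both
coefficient families are strictly contractive for some positive definite forms. -/
theorem eq_zero_of_stein {X Y W : Mat n} {C D : Fin m → Mat n} (hX : X.PosDef) (hY : Y.PosDef)
    (hC : (X - ∑ i, (C i)ᴴ * X * C i).PosDef) (hD : (Y - ∑ i, (D i)ᴴ * Y * D i).PosDef)
    (hW : W + ∑ i, (C i)ᴴ * W * D i = 0) : W = 0 := by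
  -- If `F` were positive somewhere, `F / G` would attain a maximum `N > 0` on the sphere, at some
  -- `q`. The equation and the contractivity of `C`, `D` would then give `F q < N * G q = F q`.
  let F : (Fin n → ℂ) × (Fin n → ℂ) → ℝ := fun p => reForm W p.1 p.2
  let G : (Fin n → ℂ) × (Fin n → ℂ) → ℝ := fun p => reForm X p.1 p.1 + reForm Y p.2 p.2
  have hGpos : ∀ p, p ≠ 0 → 0 < G p := fun p hp => reForm_add_pos hX hY hp
  have key : ∀ p, F p ≤ 0 := by
    by_contra! hcon
    obtain ⟨p₀, hp₀⟩ := hcon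
    have hF0 : F 0 = 0 := by simp [F, reForm]
    have hp₀0 : p₀ ≠ 0 := by rintro rfl; linarith
    have hcont : ContinuousOn (fun p => F p / G p) (Metric.sphere 0 1) := by
      apply ContinuousOn.div
      · exact (continuous_reForm W continuous_fst continuous_snd).continuousOn
      · exact ((continuous_reForm X continuous_fst continuous_fst).add
          (continuous_reForm Y continuous_snd continuous_snd)).continuousOn
      · intro p hp
        exact (hGpos p (by rintro rfl; simp at hp)).ne'
    have hscale : ∀ p : (Fin n → ℂ) × (Fin n → ℂ), p ≠ 0 →
        (‖p‖⁻¹ • p) ∈ Metric.sphere (0 : (Fin n → ℂ) × (Fin n → ℂ)) 1 ∧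
        F (‖p‖⁻¹ • p) / G (‖p‖⁻¹ • p) = F p / G p := by
      intro p hp
      have hp' : ‖p‖ ≠ 0 := norm_ne_zero_iff.2 hp
      refine ⟨by simp [norm_smul, hp'], ?_⟩
      simp only [F, G, Prod.smul_fst, Prod.smul_snd, reForm_smul, ← mul_add]
      exact mul_div_mul_left _ _ (by positivity)
    obtain ⟨q, hq, hmax⟩ := (isCompact_sphere (0 : (Fin n → ℂ) × (Fin n → ℂ)) 1).exists_isMaxOn
      ⟨_, (hscale p₀ hp₀0).1⟩ hcont
    have hq0 : q ≠ 0 := by rintro rfl; simp at hq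
    set N := F q / G q with hN
    have hle : ∀ p, F p ≤ N * G p := by
      intro p
      by_cases hp : p = 0
      · subst hp
        simp [F, G, reForm]
      · have h := hmax (hscale p hp).1
        simp only [Set.mem_ofPred_eq, (hscale p hp).2] at h
        exact (div_le_iff₀ (hGpos p hp)).1 h
    have hNpos : 0 < N := by
      have h := hmax (hscale p₀ hp₀0).1
      simp only [Set.mem_ofPred_eq, (hscale p₀ hp₀0).2] at h
      exact lt_of_lt_of_le (div_pos hp₀ (hGpos _ hp₀0)) h
    -- The minus sign of the equation is absorbed into the second vector, where `G` does not see it.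
    have h1 : F q = ∑ i, F (C i *ᵥ q.1, -(D i *ᵥ q.2)) := by
      have h := congrArg (fun M => reForm M q.1 q.2) hW
      simp only [reForm_add, reForm_sum, reForm_conj] at h
      have h0 : reForm (0 : Mat n) q.1 q.2 = 0 := by simp [reForm]
      simp only [F, reForm_neg_right, Finset.sum_neg_distrib]
      linarith
    have h2 : F q ≤ N * ∑ i, G (C i *ᵥ q.1, D i *ᵥ q.2) := by
      rw [h1, Finset.mul_sum]
      refine Finset.sum_le_sum fun i _ => (hle _).trans_eq ?_
      simp [G, reForm, mulVec_neg]
    have h3 : ∑ i, G (C i *ᵥ q.1, D i *ᵥ q.2) < G q := by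
      have h := reForm_add_pos hC hD hq0
      simp only [reForm_sub, reForm_sum, reForm_conj] at h
      simp only [G, Finset.sum_add_distrib]
      linarith
    have h4 : F q = N * G q := by rw [hN, div_mul_cancel₀ _ (hGpos q hq0).ne']
    nlinarith
  have hv : ∀ v, W *ᵥ v = 0 := by
    intro v
    have h := key (W *ᵥ v, v)
    by_contra hne
    have : 0 < star (W *ᵥ v) ⬝ᵥ (W *ᵥ v) := dotProduct_star_self_pos_iff.2 hne
    have := (Complex.lt_def.1 this).1
    simp only [F, reForm] at h
    simp only [Complex.zero_re] at this
    linarith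
  ext i j
  simpa using congrFun (hv (Pi.single j 1)) i

lemma isUnit_det_of_posDef {X : Mat n} (hX : X.PosDef) : IsUnit X.det :=
  (isUnit_iff_isUnit_det X).1 hX.isUnit

lemma inv_sub_inv_of_posDef {X Y : Mat n} (hX : X.PosDef) (hY : Y.PosDef) :
    X⁻¹ - Y⁻¹ = -(X⁻¹ * (X - Y) * Y⁻¹) := by
  rw [mul_sub, sub_mul, nonsing_inv_mul _ (isUnit_det_of_posDef hX), mul_assoc,
    mul_nonsing_inv _ (isUnit_det_of_posDef hY)]
  simp

lemma stein_of_isPosDefSolution {A : Fin m → Mat n} {Q X : Mat n} (hX : IsPosDefSolution A Q X) :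
    X - ∑ i, (B A X i)ᴴ * X * B A X i = Q := by
  rw [← hX.2]
  congr 1
  refine Finset.sum_congr rfl fun i _ => ?_
  have hinv : (X⁻¹)ᴴ = X⁻¹ := hX.1.inv.isHermitian
  simp only [B, conjTranspose_mul, hinv]
  rw [mul_assoc (A i)ᴴ, nonsing_inv_mul _ (isUnit_det_of_posDef hX.1), mul_one, ← mul_assoc]

/-- Since `X⁻¹ - Y⁻¹ = -X⁻¹ (X - Y) Y⁻¹`, the difference of two solutions solves a Stein equation
with the family `X⁻¹ Aᵢ` on the left and `Y⁻¹ Aᵢ` on the right. This is why `eq_zero_of_stein`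
allows two families. -/
theorem IsPosDefSolution.unique {A : Fin m → Mat n} {Q X Y : Mat n} (hQ : Q.PosDef)
    (hX : IsPosDefSolution A Q X) (hY : IsPosDefSolution A Q Y) : X = Y := by
  rw [← sub_eq_zero]
  refine eq_zero_of_stein (C := B A X) (D := B A Y) hX.1 hY.1
    (by rwa [stein_of_isPosDefSolution hX]) (by rwa [stein_of_isPosDefSolution hY]) ?_
  have h : X - Y = ∑ i, (A i)ᴴ * (X⁻¹ - Y⁻¹) * A i := by
    have := hX.2.trans hY.2.symm
    simp only [mul_sub, sub_mul, Finset.sum_sub_distrib]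
    rw [sub_eq_sub_iff_add_eq_add] at this ⊢
    rw [add_comm _ Y, ← this]
  have hinv : (X⁻¹)ᴴ = X⁻¹ := hX.1.inv.isHermitian
  nth_rewrite 1 [h]
  rw [← Finset.sum_add_distrib]
  refine Finset.sum_eq_zero fun i _ => ?_
  rw [inv_sub_inv_of_posDef hX.1 hY.1]
  simp only [B, conjTranspose_mul, hinv]
  noncomm_ring

lemma coe_L (A : Fin m → Mat n) (X : Mat n) (W : Herm n) :
    (L A X W : Mat n) = W + ∑ i, (B A X i)ᴴ * (W : Mat n) * B A X i := rfl

lemma coe_S (A : Fin m → Mat n) (X : Mat n) (i : Fin m) (Z : Mat n) :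
    (S A X i Z : Mat n) = (B A X i)ᴴ * Z + Zᴴ * B A X i := rfl

theorem L_isInvertible {A : Fin m → Mat n} {Q X : Mat n} (hQ : Q.PosDef)
    (hX : IsPosDefSolution A Q X) : (L A X).IsInvertible := by
  have hinj : Function.Injective (L A X).toLinearMap := by
    rw [injective_iff_map_eq_zero]
    intro W hW
    apply Subtype.ext
    have hpos : (X - ∑ i, (B A X i)ᴴ * X * B A X i).PosDef := by
      rwa [stein_of_isPosDefSolution hX]
    exact eq_zero_of_stein hX.1 hX.1 hpos hpos (congrArg Subtype.val hW)
  refine ⟨(LinearEquiv.ofInjectiveEndo _ hinj).toContinuousLinearEquiv, ?_⟩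
  ext W
  rfl

-- The smallest eigenvalue of `X` is `‖X⁻¹‖⁻¹`, and `H ≥ -‖H‖`.
open MatrixOrder in
theorem posDef_add_of_norm_lt {X H : Mat n} (hX : X.PosDef) (hH : H.IsHermitian)
    (h : ‖X⁻¹‖ * ‖H‖ < 1) : (X + H).PosDef := by
  rcases Nat.eq_zero_or_pos n with rfl | hn
  · rwa [Subsingleton.elim (X + H) X]
  have : Nonempty (Fin n) := ⟨⟨0, hn⟩⟩
  obtain ⟨u, hu⟩ := hX.isUnit
  have huinv : ((u⁻¹ : (Mat n)ˣ) : Mat n) = X⁻¹ := by rw [← hu, coe_units_inv]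
  have hz : 0 < ‖X⁻¹‖ := norm_pos_iff.2 hX.inv.isUnit.ne_zero
  have h1 : X⁻¹ ≤ algebraMap ℝ (Mat n) ‖X⁻¹‖ := IsSelfAdjoint.le_algebraMap_norm_self
    (ha := hX.inv.isHermitian)
  have h2 : algebraMap ℝ (Mat n) ‖X⁻¹‖⁻¹ ≤ X := by
    let w : (Mat n)ˣ := Units.map (algebraMap ℝ (Mat n)).toMonoidHom (Units.mk0 _ hz.ne')
    have := CStarAlgebra.inv_le_inv (a := u⁻¹) (b := w)
      (by rw [huinv]; exact hX.inv.posSemidef.nonneg) (by rw [huinv]; exact h1)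
    rwa [inv_inv, hu] at this
  have h3 : -algebraMap ℝ (Mat n) ‖H‖ ≤ H := IsSelfAdjoint.neg_algebraMap_norm_le_self
    (ha := hH)
  have h4 : (X + H - algebraMap ℝ (Mat n) (‖X⁻¹‖⁻¹ - ‖H‖)).PosSemidef := by
    rw [← nonneg_iff_posSemidef, sub_nonneg, map_sub, sub_eq_add_neg]
    exact add_le_add h2 h3
  have hc : 0 < ‖X⁻¹‖⁻¹ - ‖H‖ := by
    rw [sub_pos, ← one_div, lt_div_iff₀ hz, mul_comm]
    exact h
  have h5 : (algebraMap ℝ (Mat n) (‖X⁻¹‖⁻¹ - ‖H‖)).PosDef := by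
    rw [Algebra.algebraMap_eq_smul_one]
    exact PosDef.one.smul hc
  simpa using h5.add_posSemidef h4

end Uniqueness

/-! ### The equation for the perturbation `H` and estimates of its remainder -/

section Estimates

open Matrix

variable {m n : ℕ}

lemma norm_conjTranspose_mul_mul_le (U M V : Mat n) : ‖Uᴴ * M * V‖ ≤ ‖U‖ * ‖M‖ * ‖V‖ := by
  refine (norm_mul_le _ _).trans ?_
  gcongr
  refine (norm_mul_le _ _).trans ?_
  rw [l2_opNorm_conjTranspose]

lemma norm_conjTranspose_mul_mul_le_of_le {U V : Mat n} {p q : ℝ} (hU : ‖U‖ ≤ p) (hV : ‖V‖ ≤ q)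
    (M : Mat n) : ‖Uᴴ * M * V‖ ≤ p * ‖M‖ * q :=
  (norm_conjTranspose_mul_mul_le U M V).trans
    (mul_le_mul (mul_le_mul_of_nonneg_right hU (norm_nonneg _)) hV (norm_nonneg _)
      (mul_nonneg ((norm_nonneg _).trans hU) (norm_nonneg _)))

lemma inv_mul_sub_inv_mul {X H : Mat n} (hX : X.PosDef) (hY : (X + H).PosDef) (M : Mat n) :
    X⁻¹ * M - (X + H)⁻¹ * M = X⁻¹ * H * ((X + H)⁻¹ * M) := by
  rw [← sub_mul, inv_sub_inv_of_posDef hX hY]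
  noncomm_ring

/-- Keeping `‖X⁻¹ * M‖` instead of `ζ ‖M‖` is what lets `‖Bᵢ‖`, and hence `θ`, appear in the final
bound. -/
lemma norm_add_inv_mul_le {X H : Mat n} {x : ℝ} (hX : X.PosDef) (hY : (X + H).PosDef)
    (hH : ‖H‖ ≤ x) (hx : zeta X * x < 1) (M : Mat n) :
    ‖(X + H)⁻¹ * M‖ ≤ (1 - zeta X * x)⁻¹ * ‖X⁻¹ * M‖ := by
  have h1 : (X + H)⁻¹ * M = X⁻¹ * M - X⁻¹ * H * ((X + H)⁻¹ * M) := by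
    rw [← inv_mul_sub_inv_mul hX hY]; abel
  have h2 : ‖X⁻¹ * H * ((X + H)⁻¹ * M)‖ ≤ zeta X * x * ‖(X + H)⁻¹ * M‖ := by
    refine (norm_mul_le _ _).trans ?_
    gcongr
    refine (norm_mul_le _ _).trans ?_
    rw [zeta]
    gcongr
  have h3 := norm_sub_le (X⁻¹ * M) (X⁻¹ * H * ((X + H)⁻¹ * M))
  rw [← h1] at h3
  rw [inv_mul_eq_div, le_div_iff₀ (by linarith)]
  linarith

lemma norm_inv_mul_sub_le {X H : Mat n} {x : ℝ} (hX : X.PosDef) (hY : (X + H).PosDef)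
    (hH : ‖H‖ ≤ x) (hx : zeta X * x < 1) (M : Mat n) :
    ‖X⁻¹ * M - (X + H)⁻¹ * M‖ ≤ ((1 - zeta X * x)⁻¹ - 1) * ‖X⁻¹ * M‖ := by
  have hx0 : 0 ≤ x := (norm_nonneg _).trans hH
  have h1 : (1 - zeta X * x)⁻¹ - 1 = zeta X * x * (1 - zeta X * x)⁻¹ := by
    have : 1 - zeta X * x ≠ 0 := by linarith
    field_simp
    ring
  rw [inv_mul_sub_inv_mul hX hY, h1, mul_assoc (zeta X * x)]
  refine (norm_mul_le _ _).trans ?_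
  have h2 := norm_add_inv_mul_le hX hY hH hx M
  have h3 : ‖X⁻¹ * H‖ ≤ zeta X * x := by
    refine (norm_mul_le _ _).trans ?_
    rw [zeta]
    gcongr
  exact mul_le_mul h3 h2 (norm_nonneg _) ((norm_nonneg _).trans h3)

/-- Every term on the right has a small factor: `b - V * a`, `b - U * a` or `d`. With `b = X⁻¹ a`
and growth factors `r`, `s`, the first two terms contribute `(s - 1) + (r - 1) s = r s - 1`, and the
last two form a summand of `τ`. -/
lemma conj_sub_conj_inv_eq (a d b M U V : Mat n) (hU : Uᴴ = U) :
    bᴴ * M * b + (a + d)ᴴ * -(U * M * V) * (a + d) =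
      bᴴ * M * (b - V * a) + (b - U * a)ᴴ * M * (V * a) - (U * d)ᴴ * M * (V * (a + d))
        - (U * a)ᴴ * M * (V * d) := by
  simp only [conjTranspose_add, conjTranspose_sub, conjTranspose_mul, hU]
  noncomm_ring

lemma norm_conj_add_conj_inv_sub_inv_le {X H K : Mat n} {x y : ℝ} (hX : X.PosDef)
    (hH : (X + H).PosDef) (hK : (X + K).PosDef) (hHx : ‖H‖ ≤ x) (hx : zeta X * x < 1)
    (hKy : ‖K‖ ≤ y) (hy : zeta X * y < 1) (a d : Mat n) :
    ‖(X⁻¹ * a)ᴴ * (H - K) * (X⁻¹ * a) + (a + d)ᴴ * ((X + H)⁻¹ - (X + K)⁻¹) * (a + d)‖ ≤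
      ‖H - K‖ * (‖X⁻¹ * a‖ ^ 2 * ((1 - zeta X * x)⁻¹ * (1 - zeta X * y)⁻¹ - 1) +
        (1 - zeta X * x)⁻¹ * (1 - zeta X * y)⁻¹ *
          (zeta X * (((‖a‖ + ‖d‖) * zeta X + ‖X⁻¹ * a‖) * ‖d‖))) := by
  have hUV : (X + H)⁻¹ - (X + K)⁻¹ = -((X + H)⁻¹ * (H - K) * (X + K)⁻¹) := by
    rw [inv_sub_inv_of_posDef hH hK, add_sub_add_left_eq_sub]
  rw [hUV, conj_sub_conj_inv_eq _ _ _ _ _ _ hH.inv.isHermitian]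
  have hζ : 0 ≤ zeta X := norm_nonneg _
  set r := (1 - zeta X * x)⁻¹
  set s := (1 - zeta X * y)⁻¹
  have hr0 : 0 ≤ r := inv_nonneg.2 (by linarith)
  have hs0 : 0 ≤ s := inv_nonneg.2 (by linarith)
  have hinv : ∀ M : Mat n, ‖X⁻¹ * M‖ ≤ zeta X * ‖M‖ := fun M => norm_mul_le _ _
  have hUa : ‖(X + H)⁻¹ * a‖ ≤ r * ‖X⁻¹ * a‖ := norm_add_inv_mul_le hX hH hHx hx a
  have hVa : ‖(X + K)⁻¹ * a‖ ≤ s * ‖X⁻¹ * a‖ := norm_add_inv_mul_le hX hK hKy hy a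
  have hUd : ‖(X + H)⁻¹ * d‖ ≤ r * (zeta X * ‖d‖) :=
    (norm_add_inv_mul_le hX hH hHx hx d).trans (mul_le_mul_of_nonneg_left (hinv d) hr0)
  have hVd : ‖(X + K)⁻¹ * d‖ ≤ s * (zeta X * ‖d‖) :=
    (norm_add_inv_mul_le hX hK hKy hy d).trans (mul_le_mul_of_nonneg_left (hinv d) hs0)
  have hVad : ‖(X + K)⁻¹ * (a + d)‖ ≤ s * (zeta X * (‖a‖ + ‖d‖)) :=
    (norm_add_inv_mul_le hX hK hKy hy _).trans (mul_le_mul_of_nonneg_left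
      ((hinv _).trans (mul_le_mul_of_nonneg_left (norm_add_le _ _) hζ)) hs0)
  have hbU : ‖X⁻¹ * a - (X + H)⁻¹ * a‖ ≤ (r - 1) * ‖X⁻¹ * a‖ := norm_inv_mul_sub_le hX hH hHx hx a
  have hbV : ‖X⁻¹ * a - (X + K)⁻¹ * a‖ ≤ (s - 1) * ‖X⁻¹ * a‖ := norm_inv_mul_sub_le hX hK hKy hy a
  have t1 := norm_conjTranspose_mul_mul_le_of_le (le_refl ‖X⁻¹ * a‖) hbV (H - K)
  have t2 := norm_conjTranspose_mul_mul_le_of_le hbU hVa (H - K)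
  have t3 := norm_conjTranspose_mul_mul_le_of_le hUd hVad (H - K)
  have t4 := norm_conjTranspose_mul_mul_le_of_le hUa hVd (H - K)
  refine ((norm_sub_le _ _).trans (add_le_add ((norm_sub_le _ _).trans
    (add_le_add ((norm_add_le _ _).trans (add_le_add t1 t2)) t3)) t4)).trans_eq ?_
  ring

/-- The terms of second order in the equation for the perturbation `H` of the solution. -/
def remainder (A : Fin m → Mat n) {X : Mat n} (hX : X.IsHermitian) (D : Fin m → Mat n)
    (H : Herm n) : Herm n :=
  ⟨∑ i, ((D i)ᴴ * X⁻¹ * D i + ((B A X i)ᴴ * (H : Mat n) * B A X i +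
      (A i + D i)ᴴ * ((X + (H : Mat n))⁻¹ - X⁻¹) * (A i + D i))), by
    have hH : (H : Mat n)ᴴ = H := H.2
    have h1 : (X⁻¹)ᴴ = X⁻¹ := hX.inv
    have h2 : ((X + (H : Mat n))⁻¹)ᴴ = (X + (H : Mat n))⁻¹ := IsHermitian.inv (hX.add hH)
    change _ᴴ = _
    simp [Matrix.conjTranspose_sum, Matrix.conjTranspose_mul, hH, h1, h2, Matrix.mul_assoc]⟩

/-- `τ = l σ`, free of division. -/
def tau (A : Fin m → Mat n) (X : Mat n) (D : Fin m → Mat n) : ℝ :=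
  zeta X * ∑ i, ((‖A i‖ + ‖D i‖) * zeta X + ‖B A X i‖) * ‖D i‖

lemma theta_nonneg (A : Fin m → Mat n) (X : Mat n) : 0 ≤ theta A X :=
  Finset.sum_nonneg fun _ _ => by positivity

lemma zeta_nonneg (X : Mat n) : 0 ≤ zeta X := norm_nonneg _

lemma tau_nonneg (A : Fin m → Mat n) (X : Mat n) (D : Fin m → Mat n) : 0 ≤ tau A X D := by
  have := zeta_nonneg X
  exact mul_nonneg this (Finset.sum_nonneg fun _ _ => by positivity)

lemma sigma_eq (A : Fin m → Mat n) (X : Mat n) (D : Fin m → Mat n) :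
    sigma A X D = ‖Linv A X‖ * tau A X D := by
  rw [sigma, tau, ell, div_inv_eq_mul]; ring

/-- Two separate radii serve two uses: `y = 0` yields the growth bound for the self-map, and `y = x`
the Lipschitz constant. -/
lemma norm_remainder_sub_le (A : Fin m → Mat n) {X : Mat n} (hX : X.PosDef) (D : Fin m → Mat n)
    {H K : Herm n} {x y : ℝ} (hHx : ‖H‖ ≤ x) (hx : zeta X * x < 1)
    (hKy : ‖K‖ ≤ y) (hy : zeta X * y < 1) :
    ‖remainder A hX.isHermitian D H - remainder A hX.isHermitian D K‖ ≤
      ‖H - K‖ * (theta A X * ((1 - zeta X * x)⁻¹ * (1 - zeta X * y)⁻¹ - 1) +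
        (1 - zeta X * x)⁻¹ * (1 - zeta X * y)⁻¹ * tau A X D) := by
  have hζ := zeta_nonneg X
  have hH : (X + (H : Mat n)).PosDef := posDef_add_of_norm_lt hX H.2
    ((mul_le_mul_of_nonneg_left hHx hζ).trans_lt hx)
  have hK : (X + (K : Mat n)).PosDef := posDef_add_of_norm_lt hX K.2
    ((mul_le_mul_of_nonneg_left hKy hζ).trans_lt hy)
  have h : ((remainder A hX.isHermitian D H - remainder A hX.isHermitian D K : Herm n) : Mat n) =
      ∑ i, ((X⁻¹ * A i)ᴴ * ((H : Mat n) - K) * (X⁻¹ * A i) +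
        (A i + D i)ᴴ * ((X + (H : Mat n))⁻¹ - (X + (K : Mat n))⁻¹) * (A i + D i)) := by
    simp only [remainder, AddSubgroupClass.coe_sub, ← Finset.sum_sub_distrib, B]
    refine Finset.sum_congr rfl fun i _ => ?_
    noncomm_ring
  rw [← Submodule.norm_coe, h]
  refine (norm_sum_le_of_le _ fun i _ => norm_conj_add_conj_inv_sub_inv_le hX hH hK hHx hx hKy hy
    (A i) (D i)).trans_eq ?_
  rw [← Finset.mul_sum, Finset.sum_add_distrib, ← Finset.sum_mul, ← Finset.mul_sum,
    ← Finset.mul_sum]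
  rfl

lemma norm_remainder_zero_le (A : Fin m → Mat n) {X : Mat n} (hX : X.PosDef) (D : Fin m → Mat n) :
    ‖remainder A hX.isHermitian D 0‖ ≤ ∑ i, zeta X * ‖D i‖ ^ 2 := by
  have h : ((remainder A hX.isHermitian D 0 : Herm n) : Mat n) = ∑ i, (D i)ᴴ * X⁻¹ * D i := by
    simp [remainder]
  rw [← Submodule.norm_coe, h]
  refine norm_sum_le_of_le _ fun i _ => (norm_conjTranspose_mul_mul_le _ _ _).trans_eq ?_
  rw [zeta]; ring

lemma norm_remainder_le (A : Fin m → Mat n) {X : Mat n} (hX : X.PosDef) (D : Fin m → Mat n)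
    {H : Herm n} {x : ℝ} (hHx : ‖H‖ ≤ x) (hx : zeta X * x < 1) :
    ‖remainder A hX.isHermitian D H‖ ≤ ∑ i, zeta X * ‖D i‖ ^ 2 +
      x * (theta A X * ((1 - zeta X * x)⁻¹ - 1) + (1 - zeta X * x)⁻¹ * tau A X D) := by
  have h1 := norm_remainder_sub_le A hX D (K := 0) (y := 0) hHx hx (by simp) (by simp)
  simp only [sub_zero, mul_zero, inv_one, mul_one] at h1
  have h2 := norm_remainder_zero_le A hX D
  have h3 := norm_add_le (remainder A hX.isHermitian D H - remainder A hX.isHermitian D 0)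
    (remainder A hX.isHermitian D 0)
  rw [sub_add_cancel] at h3
  have hx0 : 0 ≤ x := (norm_nonneg _).trans hHx
  have hr : 1 ≤ (1 - zeta X * x)⁻¹ :=
    one_le_inv_iff₀.2 ⟨by linarith, by linarith [mul_nonneg (zeta_nonneg X) hx0]⟩
  have h4 : 0 ≤ theta A X * ((1 - zeta X * x)⁻¹ - 1) + (1 - zeta X * x)⁻¹ * tau A X D :=
    add_nonneg (mul_nonneg (theta_nonneg A X) (by linarith))
      (mul_nonneg (by linarith) (tau_nonneg A X D))
  have h5 := mul_le_mul_of_nonneg_right hHx h4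
  linarith

lemma perturbed_equation_iff {A : Fin m → Mat n} {Q X : Mat n} (hX : IsPosDefSolution A Q X)
    (D : Fin m → Mat n) (ΔQ H : Herm n) :
    X + (H : Mat n) - ∑ i, (A i + D i)ᴴ * (X + (H : Mat n))⁻¹ * (A i + D i) = Q + ΔQ ↔
      L A X H = ΔQ + ∑ i, S A X i (D i) + remainder A hX.1.isHermitian D H := by
  have hinv : (X⁻¹)ᴴ = X⁻¹ := hX.1.inv.isHermitian
  have key : ((L A X H - (ΔQ + ∑ i, S A X i (D i) + remainder A hX.1.isHermitian D H) : Herm n)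
      : Mat n) =
      X + (H : Mat n) - ∑ i, (A i + D i)ᴴ * (X + (H : Mat n))⁻¹ * (A i + D i) - (Q + ΔQ) := by
    simp only [AddSubgroupClass.coe_sub, Submodule.coe_add, Submodule.coe_sum, coe_L, coe_S,
      remainder]
    have hsum : ∑ i, (B A X i)ᴴ * (H : Mat n) * B A X i
        - (∑ i, ((B A X i)ᴴ * D i + (D i)ᴴ * B A X i))
        - ∑ i, ((D i)ᴴ * X⁻¹ * D i + ((B A X i)ᴴ * (H : Mat n) * B A X i +
          (A i + D i)ᴴ * ((X + (H : Mat n))⁻¹ - X⁻¹) * (A i + D i))) =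
        ∑ i, (A i)ᴴ * X⁻¹ * A i
        - ∑ i, (A i + D i)ᴴ * (X + (H : Mat n))⁻¹ * (A i + D i) := by
      simp only [← Finset.sum_sub_distrib]
      refine Finset.sum_congr rfl fun i _ => ?_
      simp only [B, conjTranspose_mul, conjTranspose_add, hinv]
      noncomm_ring
    rw [sub_eq_iff_eq_add, sub_eq_iff_eq_add] at hsum
    rw [hsum, ← hX.2]
    abel
  rw [← sub_eq_zero, ← key, ← sub_eq_zero (b := ΔQ + _ + _)]
  exact Submodule.coe_eq_zero

end Estimates

/-! ### The quadratic equation for `ξ₃` -/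

section Scalar

/-- Let `k = l + lσ + 2θ`, let `R` be the square root in the threshold, and `t = lζε`. Then `k² -
4R² = l²(1 - σ)²`, so the hypothesis reads `t < k - 2R`, while the discriminant factors as `(k - 2R
- t)(k + 2R - t)`. -/
lemma discrim_pos_of_lt {l ζ θ σ ε : ℝ} (hl : 0 < l) (hζ : 0 < ζ) (hθ : 0 ≤ θ) (hσ : 0 ≤ σ)
    (h : ε < l * (1 - σ) ^ 2 / (ζ * (l + l * σ + 2 * θ + 2 * √((l * σ + θ) * (θ + l))))) :
    l * (ζ * ε) < l + l * σ + 2 * θ ∧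
      0 < l ^ 2 * (1 + ζ * ε - σ) ^ 2 - 4 * l * ζ * ε * (l + θ) := by
  have hsq : √((l * σ + θ) * (θ + l)) ^ 2 = (l * σ + θ) * (θ + l) := Real.sq_sqrt (by positivity)
  have hR0 : 0 ≤ √((l * σ + θ) * (θ + l)) := Real.sqrt_nonneg _
  set R := √((l * σ + θ) * (θ + l))
  have hlσ : 0 ≤ l * σ := by positivity
  have hk : 0 < l + l * σ + 2 * θ + 2 * R := by positivity
  rw [lt_div_iff₀ (by positivity)] at h
  have h1 : l * (ζ * ε) < l + l * σ + 2 * θ - 2 * R := by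
    refine lt_of_mul_lt_mul_right ?_ hk.le
    calc l * (ζ * ε) * (l + l * σ + 2 * θ + 2 * R)
        = l * (ε * (ζ * (l + l * σ + 2 * θ + 2 * R))) := by ring
      _ < l * (l * (1 - σ) ^ 2) := by gcongr
      _ = (l + l * σ + 2 * θ - 2 * R) * (l + l * σ + 2 * θ + 2 * R) := by
        linear_combination 4 * hsq
  refine ⟨by linarith, ?_⟩
  have h2 : 0 < (l + l * σ + 2 * θ - 2 * R - l * (ζ * ε)) *
      (l + l * σ + 2 * θ + 2 * R - l * (ζ * ε)) := mul_pos (by linarith) (by linarith)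
  refine h2.trans_eq ?_
  linear_combination -4 * hsq

lemma isLeast_root {a b c : ℝ} (ha : 0 < a) (hb : 0 < b) (hD : 0 < b ^ 2 - 4 * a * c) :
    IsLeast {ξ : ℝ | a * ξ ^ 2 - b * ξ + c = 0} (2 * c / (b + √(b ^ 2 - 4 * a * c))) ∧
      2 * a * (2 * c / (b + √(b ^ 2 - 4 * a * c))) < b := by
  have hsq : √(b ^ 2 - 4 * a * c) ^ 2 = b ^ 2 - 4 * a * c := Real.sq_sqrt hD.le
  have hs0 : 0 < √(b ^ 2 - 4 * a * c) := Real.sqrt_pos.2 hD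
  set s := √(b ^ 2 - 4 * a * c)
  have hξ : 2 * c / (b + s) = (b - s) / (2 * a) := by
    rw [div_eq_div_iff (by positivity) (by positivity)]
    linear_combination hsq
  rw [hξ]
  refine ⟨⟨?_, ?_⟩, ?_⟩
  · change a * ((b - s) / (2 * a)) ^ 2 - b * ((b - s) / (2 * a)) + c = 0
    field_simp
    linear_combination hsq
  · intro ξ hξ'
    change a * ξ ^ 2 - b * ξ + c = 0 at hξ'
    rw [div_le_iff₀ (by positivity)]
    have h1 : (b - 2 * a * ξ) ^ 2 = s ^ 2 := by rw [hsq]; linear_combination 4 * a * hξ'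
    have h2 := (abs_le.1 (abs_le_of_sq_le_sq h1.le hs0.le)).2
    linarith
  · rw [mul_div_cancel₀ _ (by positivity)]
    linarith

lemma xi3_spec {l ζ θ σ ε : ℝ} (hl : 0 < l) (hζ : 0 < ζ) (hθ : 0 ≤ θ) (hσ : 0 ≤ σ) (hσ1 : σ < 1)
    (hε : 0 ≤ ε)
    (h : ε < l * (1 - σ) ^ 2 / (ζ * (l + l * σ + 2 * θ + 2 * √((l * σ + θ) * (θ + l))))) :
    IsLeast {ξ : ℝ | ζ * (l + θ) * ξ ^ 2 - l * (1 + ζ * ε - σ) * ξ + l * ε = 0}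
        (xi3 l ζ θ σ ε) ∧
      0 ≤ xi3 l ζ θ σ ε ∧ ζ * xi3 l ζ θ σ ε < 1 ∧
      l * σ + θ < (l + θ) * (1 - ζ * xi3 l ζ θ σ ε) ^ 2 ∧
      xi3 l ζ θ σ ε * (1 - σ) ≤ 2 * ε := by
  obtain ⟨h1, hD⟩ := discrim_pos_of_lt hl hζ hθ hσ h
  have hζε : 0 ≤ ζ * ε := by positivity
  have hb : 0 < l * (1 + ζ * ε - σ) := mul_pos hl (by linarith)
  have ha : 0 < ζ * (l + θ) := by positivity
  have hDeq : (l * (1 + ζ * ε - σ)) ^ 2 - 4 * (ζ * (l + θ)) * (l * ε) =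
      l ^ 2 * (1 + ζ * ε - σ) ^ 2 - 4 * l * ζ * ε * (l + θ) := by ring
  obtain ⟨hleast, hlt⟩ := isLeast_root ha hb (hDeq ▸ hD)
  have hxi : 2 * (l * ε) / (l * (1 + ζ * ε - σ) +
      √((l * (1 + ζ * ε - σ)) ^ 2 - 4 * (ζ * (l + θ)) * (l * ε))) = xi3 l ζ θ σ ε := by
    rw [xi3, hDeq, mul_assoc 2 l ε]
  rw [hxi] at hleast hlt
  have hxi0 : 0 ≤ xi3 l ζ θ σ ε := by rw [← hxi]; positivity
  have hroot : ζ * (l + θ) * xi3 l ζ θ σ ε ^ 2 - l * (1 + ζ * ε - σ) * xi3 l ζ θ σ ε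
    + l * ε = 0 := hleast.1
  have hxile : xi3 l ζ θ σ ε * (1 - σ) ≤ 2 * ε := by
    rw [← hxi, div_mul_eq_mul_div, div_le_iff₀ (by positivity)]
    have h5 : 0 ≤ √((l * (1 + ζ * ε - σ)) ^ 2 - 4 * (ζ * (l + θ)) * (l * ε)) := Real.sqrt_nonneg _
    have h6 : l * (1 - σ) ≤ l * (1 + ζ * ε - σ) +
      √((l * (1 + ζ * ε - σ)) ^ 2 - 4 * (ζ * (l + θ)) * (l * ε)) := by nlinarith
    nlinarith
  set ξ := xi3 l ζ θ σ ε
  have hu : (l + 2 * θ - l * (ζ * ε) + l * σ) < 2 * (l + θ) * (1 - ζ * ξ) := by linarith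
  have hu0 : 0 < 1 - ζ * ξ := by
    have : 0 < 2 * (l + θ) * (1 - ζ * ξ) := by linarith
    exact pos_of_mul_pos_right this (by positivity)
  refine ⟨hleast, hxi0, by linarith, ?_, hxile⟩
  -- This is the quadratic rewritten in `u = 1 - ζξ`; its roots have product `(lσ + θ)/(l + θ)`. As
  -- `ξ` is the smaller root, `u` is the larger one, so `u²` exceeds that product.
  have h3 : l * σ + θ = (l + 2 * θ - l * (ζ * ε) + l * σ) * (1 - ζ * ξ)
      - (l + θ) * (1 - ζ * ξ) ^ 2 := by linear_combination ζ * hroot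
  have h4 := mul_lt_mul_of_pos_right hu hu0
  linarith

end Scalar

/-! ### The contraction argument and the perturbation bound -/

section Perturbation

open Matrix

variable {m n : ℕ}

/-- The map whose fixed points `H` are the perturbations of the solution. -/
def perturbationMap (A : Fin m → Mat n) {X : Mat n} (hX : X.IsHermitian) (D : Fin m → Mat n)
    (ΔQ H : Herm n) : Herm n :=
  Linv A X (ΔQ + ∑ i, S A X i (D i) + remainder A hX D H)

lemma norm_Linv_firstOrder_le (A : Fin m → Mat n) (X : Mat n) (D : Fin m → Mat n) (ΔQ : Herm n) :
    ‖Linv A X ΔQ + Linv A X (∑ i, S A X i (D i))‖ ≤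
      1 / ell A X * ‖ΔQ‖ + ∑ i, ‖P A X i‖ * ‖D i‖ := by
  refine (norm_add_le _ _).trans (add_le_add ?_ ?_)
  · rw [ell, one_div, inv_inv]
    exact (Linv A X).le_opNorm ΔQ
  · rw [map_sum]
    exact norm_sum_le_of_le _ fun i _ => (P A X i).le_opNorm (D i)

lemma eps_eq (A : Fin m → Mat n) (X : Mat n) (D : Fin m → Mat n) (ΔQ : Herm n) :
    eps A X D ΔQ = 1 / ell A X * ‖ΔQ‖ + ∑ i, ‖P A X i‖ * ‖D i‖ +
      ‖Linv A X‖ * ∑ i, zeta X * ‖D i‖ ^ 2 := by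
  rw [eps, Finset.sum_add_distrib, Finset.mul_sum, add_assoc]
  congr 2
  refine Finset.sum_congr rfl fun i _ => ?_
  rw [ell, div_inv_eq_mul]
  ring

lemma ell_nonneg (A : Fin m → Mat n) (X : Mat n) : 0 ≤ ell A X :=
  inv_nonneg.2 (Linv A X).opNorm_nonneg

lemma sigma_nonneg (A : Fin m → Mat n) (X : Mat n) (D : Fin m → Mat n) : 0 ≤ sigma A X D := by
  rw [sigma_eq]
  exact mul_nonneg (Linv A X).opNorm_nonneg (tau_nonneg A X D)

lemma eps_nonneg (A : Fin m → Mat n) (X : Mat n) (D : Fin m → Mat n) (ΔQ : Herm n) :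
    0 ≤ eps A X D ΔQ := by
  have h := ell_nonneg A X
  exact add_nonneg (mul_nonneg (one_div_nonneg.2 h) (norm_nonneg _))
    (Finset.sum_nonneg fun i _ => add_nonneg
      (mul_nonneg (P A X i).opNorm_nonneg (norm_nonneg _))
      (mul_nonneg (div_nonneg (zeta_nonneg X) h) (sq_nonneg _)))

lemma norm_perturbationMap_le (A : Fin m → Mat n) {X : Mat n} (hX : X.PosDef) (D : Fin m → Mat n)
    (ΔQ : Herm n) {H : Herm n} {x : ℝ} (hHx : ‖H‖ ≤ x) (hx : zeta X * x < 1) :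
    ‖perturbationMap A hX.isHermitian D ΔQ H‖ ≤ eps A X D ΔQ + ‖Linv A X‖ *
      (x * (theta A X * ((1 - zeta X * x)⁻¹ - 1) + (1 - zeta X * x)⁻¹ * tau A X D)) := by
  rw [perturbationMap, map_add, map_add, eps_eq, add_assoc _ (‖Linv A X‖ * _), ← mul_add]
  exact (norm_add_le _ _).trans (add_le_add (norm_Linv_firstOrder_le A X D ΔQ)
    ((Linv A X).le_opNorm_of_le (norm_remainder_le A hX D hHx hx)))

lemma norm_perturbationMap_sub_le (A : Fin m → Mat n) {X : Mat n} (hX : X.PosDef)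
    (D : Fin m → Mat n) (ΔQ : Herm n) {H K : Herm n} {x : ℝ} (hHx : ‖H‖ ≤ x) (hKx : ‖K‖ ≤ x)
    (hx : zeta X * x < 1) :
    ‖perturbationMap A hX.isHermitian D ΔQ H - perturbationMap A hX.isHermitian D ΔQ K‖ ≤
      ‖Linv A X‖ * (theta A X * ((1 - zeta X * x)⁻¹ ^ 2 - 1) +
        (1 - zeta X * x)⁻¹ ^ 2 * tau A X D) * ‖H - K‖ := by
  rw [perturbationMap, perturbationMap, ← map_sub, add_sub_add_left_eq_sub]
  refine ((Linv A X).le_opNorm_of_le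
    (norm_remainder_sub_le A hX D hHx hx hKx hx)).trans_eq ?_
  ring

lemma eq_perturbationMap_iff {A : Fin m → Mat n} {Q X : Mat n} (hQ : Q.PosDef)
    (hX : IsPosDefSolution A Q X) (D : Fin m → Mat n) (ΔQ H : Herm n) :
    perturbationMap A hX.1.isHermitian D ΔQ H = H ↔
      X + (H : Mat n) - ∑ i, (A i + D i)ᴴ * (X + (H : Mat n))⁻¹ * (A i + D i) = Q + ΔQ := by
  rw [perturbed_equation_iff hX, perturbationMap, Linv,
    (L_isInvertible hQ hX).inverse_apply_eq, eq_comm]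

theorem perturbation_bound {A : Fin m → Mat n} {Q X : Mat n} (hQ : Q.PosDef)
    (hX : IsPosDefSolution A Q X) (D : Fin m → Mat n) (ΔQ : Herm n) {X' : Mat n}
    (hQ' : (Q + (ΔQ : Mat n)).PosDef)
    (hX' : IsPosDefSolution (fun i => A i + D i) (Q + (ΔQ : Mat n)) X')
    {ξ : ℝ} (hξ0 : 0 ≤ ξ) (hξ : zeta X * ξ < 1)
    (hself : eps A X D ΔQ + ‖Linv A X‖ *
      (ξ * (theta A X * ((1 - zeta X * ξ)⁻¹ - 1) + (1 - zeta X * ξ)⁻¹ * tau A X D)) ≤ ξ)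
    (hcontr : ‖Linv A X‖ * (theta A X * ((1 - zeta X * ξ)⁻¹ ^ 2 - 1) +
        (1 - zeta X * ξ)⁻¹ ^ 2 * tau A X D) < 1) :
    ‖X' - X‖ ≤ ξ := by
  set f := perturbationMap A hX.1.isHermitian D ΔQ
  have hmaps : Set.MapsTo f (Metric.closedBall 0 ξ) (Metric.closedBall 0 ξ) := by
    intro H hH
    rw [mem_closedBall_zero_iff] at hH ⊢
    exact (norm_perturbationMap_le A hX.1 D ΔQ hH hξ).trans hself
  have hcw : ContractingWith (‖Linv A X‖ * (theta A X * ((1 - zeta X * ξ)⁻¹ ^ 2 - 1) +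
        (1 - zeta X * ξ)⁻¹ ^ 2 * tau A X D)).toNNReal (hmaps.restrict f _ _) := by
    refine ⟨by rwa [Real.toNNReal_lt_one], LipschitzWith.of_dist_le_mul fun H K => ?_⟩
    have hH := mem_closedBall_zero_iff.1 H.2
    have hK := mem_closedBall_zero_iff.1 K.2
    change dist (f H) (f K) ≤ _ * dist (H : Herm n) (K : Herm n)
    rw [dist_eq_norm (f H), dist_eq_norm (H : Herm n)]
    refine (norm_perturbationMap_sub_le A hX.1 D ΔQ hH hK hξ).trans ?_
    exact mul_le_mul_of_nonneg_right (Real.le_coe_toNNReal _) (norm_nonneg _)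
  obtain ⟨H, hH, hfix, -⟩ := hcw.exists_fixedPoint' (Metric.isClosed_closedBall.isComplete) hmaps
    (x := 0) (by simpa using hξ0) (edist_ne_top _ _)
  rw [mem_closedBall_zero_iff] at hH
  have hpos : (X + (H : Mat n)).PosDef := posDef_add_of_norm_lt hX.1 H.2
    ((mul_le_mul_of_nonneg_left hH (zeta_nonneg X)).trans_lt hξ)
  have hsol : IsPosDefSolution (fun i => A i + D i) (Q + (ΔQ : Mat n)) (X + (H : Mat n)) :=
    ⟨hpos, (eq_perturbationMap_iff hQ hX D ΔQ H).1 hfix⟩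
  -- Banach's theorem only produces some solution near `X`; uniqueness transfers the bound to `X'`.
  rw [hX'.unique hQ' hsol, add_sub_cancel_left]
  exact hH

theorem norm_sub_le_xi3 {A : Fin m → Mat n} {Q X : Mat n} (hQ : Q.PosDef)
    (hX : IsPosDefSolution A Q X) (D : Fin m → Mat n) (ΔQ : Herm n) {X' : Mat n}
    (hQ' : (Q + (ΔQ : Mat n)).PosDef)
    (hX' : IsPosDefSolution (fun i => A i + D i) (Q + (ΔQ : Mat n)) X')
    {l ζ θ σ ε : ℝ} (hl : l = ell A X) (hζ : ζ = zeta X) (hθ : θ = theta A X)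
    (hσ : σ = sigma A X D) (hε : ε = eps A X D ΔQ) (hl0 : 0 < l) (hζ0 : 0 < ζ) (hσ1 : σ < 1)
    (hlt : ε < l * (1 - σ) ^ 2 / (ζ * (l + l * σ + 2 * θ + 2 * √((l * σ + θ) * (θ + l))))) :
    ‖X' - X‖ ≤ xi3 l ζ θ σ ε := by
  have hΛ : ‖Linv A X‖ = l⁻¹ := by rw [hl, ell, inv_inv]
  have hτ : tau A X D = l * σ := by
    rw [hσ, sigma_eq, hΛ, mul_inv_cancel_left₀ hl0.ne']
  have hσ0 : 0 ≤ σ := hσ ▸ sigma_nonneg A X D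
  obtain ⟨hleast, hξ0, hξ1, hξ2, -⟩ := xi3_spec hl0 hζ0 (hθ ▸ theta_nonneg A X) hσ0 hσ1
    (hε ▸ eps_nonneg A X D ΔQ) hlt
  have hroot : ζ * (l + θ) * xi3 l ζ θ σ ε ^ 2 - l * (1 + ζ * ε - σ) * xi3 l ζ θ σ ε
    + l * ε = 0 := hleast.1
  set ξ := xi3 l ζ θ σ ε
  have hu : 0 < 1 - ζ * ξ := by linarith
  refine perturbation_bound hQ hX D ΔQ hQ' hX' hξ0 (hζ ▸ hξ1) ?_ ?_
  · rw [← hζ, ← hθ, ← hε, hτ, hΛ]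
    have hr : (1 - ζ * ξ)⁻¹ * (1 - ζ * ξ) = 1 := inv_mul_cancel₀ hu.ne'
    -- The root equation divided by `1 - ζξ`: the self-map condition holds with equality at `ξ₃`.
    have hmul : ξ * (θ * ((1 - ζ * ξ)⁻¹ - 1) + (1 - ζ * ξ)⁻¹ * (l * σ)) = l * (ξ - ε) := by
      linear_combination (1 - ζ * ξ)⁻¹ * hroot + ((l + θ) * ξ - l * ε) * hr
    rw [hmul, inv_mul_cancel_left₀ hl0.ne']
    linarith
  · rw [← hζ, ← hθ, hτ, hΛ, inv_mul_lt_iff₀ hl0]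
    have : (l * σ + θ) * (1 - ζ * ξ)⁻¹ ^ 2 < l + θ := by
      rw [inv_pow, ← div_eq_mul_inv, div_lt_iff₀ (by positivity)]
      exact hξ2
    linarith

/-- Cauchy–Schwarz applied to each row. -/
lemma norm_le_frobenius (M : Mat n) : ‖M‖ ≤ √(∑ i, ∑ j, ‖M i j‖ ^ 2) := by
  rw [← l2_opNorm_toEuclideanCLM]
  refine ContinuousLinearMap.opNorm_le_bound _ (Real.sqrt_nonneg _) fun x => ?_
  rw [EuclideanSpace.norm_eq, EuclideanSpace.norm_eq, ← Real.sqrt_mul (by positivity)]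
  refine Real.sqrt_le_sqrt ?_
  rw [Finset.sum_mul]
  refine Finset.sum_le_sum fun i _ => ?_
  have h : ‖(toEuclideanCLM (𝕜 := ℂ) M x) i‖ ≤ ∑ j, ‖M i j‖ * ‖x j‖ := by
    rw [ofLp_toEuclideanCLM]
    exact (norm_sum_le _ _).trans_eq (Finset.sum_congr rfl fun j _ => norm_mul (M i j) (x j))
  exact (pow_le_pow_left₀ (norm_nonneg _) h 2).trans (Finset.sum_mul_sq_le_sq_mul_sq _ _ _)

lemma norm_le_pertNorm_left (D : Fin m → Mat n) (ΔQ : Herm n) (k : Fin m) :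
    ‖D k‖ ≤ pertNorm D ΔQ := by
  refine (norm_le_frobenius _).trans (Real.sqrt_le_sqrt ?_)
  have h := Finset.single_le_sum (f := fun k => ∑ i, ∑ j, ‖D k i j‖ ^ 2)
    (fun _ _ => by positivity) (Finset.mem_univ k)
  refine h.trans (le_add_of_nonneg_right (by positivity))

lemma norm_le_pertNorm_right (D : Fin m → Mat n) (ΔQ : Herm n) :
    ‖ΔQ‖ ≤ pertNorm D ΔQ := by
  refine (norm_le_frobenius _).trans (Real.sqrt_le_sqrt ?_)
  exact le_add_of_nonneg_left (by positivity)

/-- The bound for `‖X' - X‖` follows from the expansion with the same constant. -/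
lemma norm_sub_le_of_expansion (A : Fin m → Mat n) (X X' : Mat n) (D : Fin m → Mat n)
    (ΔQ : Herm n) {c : ℝ}
    (h : ‖(X' - X) - ((Linv A X ΔQ : Herm n) : Mat n)
      - ((Linv A X (∑ i, S A X i (D i)) : Herm n) : Mat n)‖ ≤ c) :
    ‖X' - X‖ ≤ 1 / ell A X * ‖ΔQ‖ + ∑ i, ‖P A X i‖ * ‖D i‖ + c := by
  have h1 := norm_Linv_firstOrder_le A X D ΔQ
  rw [← Submodule.norm_coe, Submodule.coe_add] at h1
  have h2 := norm_add_le (((Linv A X ΔQ : Herm n) : Mat n)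
      + ((Linv A X (∑ i, S A X i (D i)) : Herm n) : Mat n))
    ((X' - X) - ((Linv A X ΔQ : Herm n) : Mat n)
      - ((Linv A X (∑ i, S A X i (D i)) : Herm n) : Mat n))
  have h3 : ((Linv A X ΔQ : Herm n) : Mat n)
      + ((Linv A X (∑ i, S A X i (D i)) : Herm n) : Mat n) +
    ((X' - X) - ((Linv A X ΔQ : Herm n) : Mat n)
      - ((Linv A X (∑ i, S A X i (D i)) : Herm n) : Mat n)) = X' - X := by abel
  rw [h3] at h2
  linarith

/-- The deviation from the first order expansion is `L⁻¹` of the remainder. -/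
lemma norm_sub_firstOrder_le {A : Fin m → Mat n} {Q X : Mat n} (hQ : Q.PosDef)
    (hX : IsPosDefSolution A Q X) (D : Fin m → Mat n) (ΔQ : Herm n) {X' : Mat n}
    (hX' : IsPosDefSolution (fun i => A i + D i) (Q + (ΔQ : Mat n)) X') {x : ℝ}
    (hx : ‖X' - X‖ ≤ x) (hζx : zeta X * x < 1) :
    ‖(X' - X) - ((Linv A X ΔQ : Herm n) : Mat n)
      - ((Linv A X (∑ i, S A X i (D i)) : Herm n) : Mat n)‖ ≤
    ‖Linv A X‖ * (∑ i, zeta X * ‖D i‖ ^ 2 +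
      x * (theta A X * ((1 - zeta X * x)⁻¹ - 1) + (1 - zeta X * x)⁻¹ * tau A X D)) := by
  let H : Herm n := ⟨X' - X, hX'.1.isHermitian.sub hX.1.isHermitian⟩
  have hXH : X + (H : Mat n) = X' := add_sub_cancel _ _
  have hfix : perturbationMap A hX.1.isHermitian D ΔQ H = H := by
    rw [eq_perturbationMap_iff hQ hX, hXH]
    exact hX'.2
  have hdiff : H - Linv A X ΔQ - Linv A X (∑ i, S A X i (D i)) =
      Linv A X (remainder A hX.1.isHermitian D H) := by
    nth_rewrite 1 [← hfix]
    rw [perturbationMap, map_add, map_add]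
    abel
  have := (Linv A X).le_opNorm_of_le (norm_remainder_le A hX.1 D (H := H) hx hζx)
  rw [← hdiff] at this
  exact this

end Perturbation

/-! ### First order expansion with explicit quadratic error -/

section Asymptotics

open Matrix

variable {m n : ℕ}

/-- `L⁻¹` cannot kill the identity matrix. For `n = 0` the norm vanishes and `ell` takes the default
value `0`, so that case is treated apart. -/
lemma norm_Linv_pos (hn : 0 < n) {A : Fin m → Mat n} {Q X : Mat n} (hQ : Q.PosDef)
    (hX : IsPosDefSolution A Q X) : 0 < ‖Linv A X‖ := by
  have : Nonempty (Fin n) := ⟨⟨0, hn⟩⟩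
  refine lt_of_le_of_ne (Linv A X).opNorm_nonneg fun h0 => ?_
  let W : Herm n := ⟨1, isHermitian_one⟩
  have h1 : L A X (Linv A X W) = W := (L_isInvertible hQ hX).self_apply_inverse W
  have h2 : Linv A X W = 0 := by
    have h3 := (Linv A X).le_opNorm W
    rw [← h0, zero_mul] at h3
    exact norm_le_zero_iff.1 h3
  rw [h2, map_zero] at h1
  exact one_ne_zero (congrArg Subtype.val h1).symm

lemma zeta_pos (hn : 0 < n) {X : Mat n} (hX : X.PosDef) : 0 < zeta X := by
  have : Nonempty (Fin n) := ⟨⟨0, hn⟩⟩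
  exact norm_pos_iff.2 hX.inv.isUnit.ne_zero

lemma mul_lt_of_lt_div_add_one {k p e : ℝ} (hk : 0 ≤ k) (hp : 0 ≤ p) (h : p < e / (k + 1)) :
    k * p < e := by
  rw [lt_div_iff₀ (by positivity)] at h
  linarith

lemma exists_eps_le_mul (A : Fin m → Mat n) (X : Mat n) :
    ∃ c : ℝ, 0 ≤ c ∧ ∀ (D : Fin m → Mat n) (ΔQ : Herm n) (p : ℝ), p ≤ 1 → (∀ i, ‖D i‖ ≤ p) →
      ‖ΔQ‖ ≤ p → eps A X D ΔQ ≤ c * p := by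
  have hζ := zeta_nonneg X
  have hΛ := (Linv A X).opNorm_nonneg
  have hP : ∀ i, 0 ≤ ‖P A X i‖ := fun i => (P A X i).opNorm_nonneg
  refine ⟨‖Linv A X‖ + ∑ i, ‖P A X i‖ + ‖Linv A X‖ * ∑ _i : Fin m, zeta X,
    add_nonneg (add_nonneg hΛ (Finset.sum_nonneg fun i _ => hP i))
      (mul_nonneg hΛ (Finset.sum_nonneg fun _ _ => hζ)), fun D ΔQ p hp1 hD hΔQ => ?_⟩
  rw [eps_eq, ell, one_div, inv_inv, add_mul, add_mul, Finset.sum_mul, mul_assoc ‖Linv A X‖,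
    Finset.sum_mul]
  refine add_le_add (add_le_add (mul_le_mul_of_nonneg_left hΔQ hΛ)
    (Finset.sum_le_sum fun i _ => mul_le_mul_of_nonneg_left (hD i) (hP i)))
    (mul_le_mul_of_nonneg_left (Finset.sum_le_sum fun i _ => mul_le_mul_of_nonneg_left ?_ hζ) hΛ)
  nlinarith [hD i, norm_nonneg (D i)]

lemma exists_tau_le_mul (A : Fin m → Mat n) (X : Mat n) :
    ∃ c : ℝ, 0 ≤ c ∧ ∀ (D : Fin m → Mat n) (p : ℝ), p ≤ 1 → (∀ i, ‖D i‖ ≤ p) →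
      tau A X D ≤ c * p := by
  have hζ := zeta_nonneg X
  have hc : ∀ i, 0 ≤ (‖A i‖ + 1) * zeta X + ‖B A X i‖ := fun i =>
    add_nonneg (mul_nonneg (add_nonneg (norm_nonneg _) zero_le_one) hζ) (norm_nonneg _)
  refine ⟨zeta X * ∑ i, ((‖A i‖ + 1) * zeta X + ‖B A X i‖),
    mul_nonneg hζ (Finset.sum_nonneg fun i _ => hc i), fun D p hp1 hD => ?_⟩
  rw [tau, mul_assoc, Finset.sum_mul]
  refine mul_le_mul_of_nonneg_left (Finset.sum_le_sum fun i _ => ?_) hζ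
  have h1 : ‖D i‖ ≤ 1 := (hD i).trans hp1
  exact mul_le_mul (add_le_add_left (mul_le_mul_of_nonneg_right (add_le_add_right h1 _) hζ) _)
    (hD i) (norm_nonneg _) (hc i)

/-- A threshold for `ε` independent of `σ`: the square root is at most `θ + l`, so the bracket is at
most `4(l + θ)`, and `(1 - σ)² ≥ 1/4`. -/
lemma threshold_le {l ζ θ σ : ℝ} (hl : 0 < l) (hζ : 0 < ζ) (hθ : 0 ≤ θ) (hσ : 0 ≤ σ)
    (hσ2 : σ ≤ 1 / 2) :
    l / (16 * ζ * (l + θ)) ≤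
      l * (1 - σ) ^ 2 / (ζ * (l + l * σ + 2 * θ + 2 * √((l * σ + θ) * (θ + l)))) := by
  have hlσ : l * σ ≤ l := by nlinarith
  have hR : √((l * σ + θ) * (θ + l)) ≤ θ + l := by
    rw [Real.sqrt_le_left (by positivity)]
    nlinarith
  have hR0 := Real.sqrt_nonneg ((l * σ + θ) * (θ + l))
  calc l / (16 * ζ * (l + θ)) = l * (1 / 2) ^ 2 / (ζ * (4 * (l + θ))) := by
        field_simp
        ring
    _ ≤ _ := by
        gcongr
        · linarith
        · linarith

lemma remainder_majorant_le {m : ℕ} {ζ θ c₁ c₂ p τ : ℝ} {d : Fin m → ℝ} (hζ : 0 ≤ ζ)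
    (hθ : 0 ≤ θ) (hc₁ : 0 ≤ c₁) (hp : 0 ≤ p) (hτ0 : 0 ≤ τ) (hτ : τ ≤ c₂ * p)
    (hd0 : ∀ i, 0 ≤ d i) (hd : ∀ i, d i ≤ p) (h : ζ * (4 * (c₁ * p)) ≤ 1 / 2) :
    ∑ i, ζ * d i ^ 2 + 4 * (c₁ * p) * (θ * ((1 - ζ * (4 * (c₁ * p)))⁻¹ - 1)
      + (1 - ζ * (4 * (c₁ * p)))⁻¹ * τ) ≤
    (m * ζ + 4 * c₁ * (8 * θ * ζ * c₁ + 2 * c₂)) * p ^ 2 := by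
  have hr : (1 - ζ * (4 * (c₁ * p)))⁻¹ ≤ 2 := by
    rw [inv_le_comm₀ (by linarith) two_pos]
    linarith
  have hr1 : (1 - ζ * (4 * (c₁ * p)))⁻¹ - 1 ≤ 2 * (ζ * (4 * (c₁ * p))) := by
    have h1 : (1 - ζ * (4 * (c₁ * p)))⁻¹ * (1 - ζ * (4 * (c₁ * p))) = 1 :=
      inv_mul_cancel₀ (by linarith)
    have h2 := mul_le_mul_of_nonneg_right hr (show 0 ≤ ζ * (4 * (c₁ * p)) by positivity)
    linarith
  have hsum : ∑ i, ζ * d i ^ 2 ≤ m * ζ * p ^ 2 := by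
    refine (Finset.sum_le_sum (g := fun _ => ζ * p ^ 2) fun i _ => ?_).trans_eq
      (by simp [mul_assoc])
    exact mul_le_mul_of_nonneg_left (pow_le_pow_left₀ (hd0 i) (hd i) 2) hζ
  have hτ' : (1 - ζ * (4 * (c₁ * p)))⁻¹ * τ ≤ 2 * (c₂ * p) := mul_le_mul hr hτ hτ0 zero_le_two
  have hmain := mul_le_mul_of_nonneg_left (add_le_add (mul_le_mul_of_nonneg_left hr1 hθ) hτ')
    (show 0 ≤ 4 * (c₁ * p) by positivity)
  refine (add_le_add hsum hmain).trans_eq ?_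
  ring

/-- The factor 4 comes from `ξ₃ (1 - σ) ≤ 2ε` and `σ ≤ 1/2`. -/
lemma norm_sub_le_four_mul_eps {A : Fin m → Mat n} {Q X : Mat n} (hn : 0 < n) (hQ : Q.PosDef)
    (hX : IsPosDefSolution A Q X) {D : Fin m → Mat n} {ΔQ : Herm n} {X' : Mat n}
    (hQ' : (Q + (ΔQ : Mat n)).PosDef)
    (hX' : IsPosDefSolution (fun i => A i + D i) (Q + (ΔQ : Mat n)) X')
    (hσ : sigma A X D ≤ 1 / 2)
    (hε : eps A X D ΔQ < ell A X / (16 * zeta X * (ell A X + theta A X))) :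
    ‖X' - X‖ ≤ 4 * eps A X D ΔQ := by
  have hζ := zeta_pos hn hX.1
  have hl : 0 < ell A X := inv_pos.2 (norm_Linv_pos hn hQ hX)
  have hθ := theta_nonneg A X
  have hσ0 := sigma_nonneg A X D
  have hlt := hε.trans_le (threshold_le hl hζ hθ hσ0 hσ)
  have hxi := norm_sub_le_xi3 hQ hX D ΔQ hQ' hX' rfl rfl rfl rfl rfl hl hζ (by linarith) hlt
  obtain ⟨-, hξ0, -, -, hξle⟩ := xi3_spec hl hζ hθ hσ0 (by linarith) (eps_nonneg A X D ΔQ) hlt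
  nlinarith

theorem firstOrder_expansion {A : Fin m → Mat n} {Q X : Mat n} (hQ : Q.PosDef)
    (hX : IsPosDefSolution A Q X) :
    ∃ C δ : ℝ, 0 < δ ∧ ∀ (D : Fin m → Mat n) (ΔQ : Herm n) (X' : Mat n),
      IsPosDefSolution (fun i => A i + D i) (Q + (ΔQ : Mat n)) X' → pertNorm D ΔQ < δ →
      ‖(X' - X) - ((Linv A X ΔQ : Herm n) : Mat n)
        - ((Linv A X (∑ i, S A X i (D i)) : Herm n) : Mat n)‖ ≤ C * pertNorm D ΔQ ^ 2 := by
  rcases Nat.eq_zero_or_pos n with rfl | hn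
  · refine ⟨0, 1, one_pos, fun D ΔQ X' _ _ => ?_⟩
    rw [Subsingleton.elim (X' - X - _ - _) 0]
    simp
  have hΛ := norm_Linv_pos hn hQ hX
  have hζ := zeta_pos hn hX.1
  have hl : 0 < ell A X := inv_pos.2 hΛ
  have hθ := theta_nonneg A X
  obtain ⟨c₁, hc₁, hε⟩ := exists_eps_le_mul A X
  obtain ⟨c₂, hc₂, hτ⟩ := exists_tau_le_mul A X
  obtain ⟨Λ, hΛdef⟩ : ∃ Λ, Λ = ‖Linv A X‖ := ⟨_, rfl⟩
  rw [← hΛdef] at hΛ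
  obtain ⟨e, he⟩ : ∃ e, e = ell A X / (16 * zeta X * (ell A X + theta A X)) := ⟨_, rfl⟩
  have he0 : 0 < e := by rw [he]; positivity
  have hζe : zeta X * e ≤ 1 / 16 := by
    rw [he, mul_div_assoc', div_le_div_iff₀ (by positivity) (by positivity)]
    nlinarith [mul_nonneg hζ.le hθ]
  -- The constant is `Λ` times that of `remainder_majorant_le`. The four entries of the minimum
  -- ensure, in order: `p ≤ 1`, `σ ≤ 1/2`, `ε` below the threshold `e`, and positive definiteness of
  -- `Q + ΔQ`.
  refine ⟨Λ * (m * zeta X + 4 * c₁ * (8 * theta A X * zeta X * c₁ + 2 * c₂)),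
    min 1 (min ((1 / 2) / (Λ * c₂ + 1)) (min (e / (c₁ + 1)) (1 / (‖Q⁻¹‖ + 1)))),
    by positivity, fun D ΔQ X' hX' hp => ?_⟩
  simp only [lt_min_iff] at hp
  obtain ⟨hp1, hpσ, hpε, hpQ⟩ := hp
  have hD := norm_le_pertNorm_left D ΔQ
  have hΔQ := norm_le_pertNorm_right D ΔQ
  generalize pertNorm D ΔQ = p at *
  have hp0 : 0 ≤ p := (norm_nonneg _).trans hΔQ
  have hσp := mul_lt_of_lt_div_add_one (mul_nonneg hΛ.le hc₂) hp0 hpσ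
  have hεp := mul_lt_of_lt_div_add_one hc₁ hp0 hpε
  have hQp := mul_lt_of_lt_div_add_one (norm_nonneg _) hp0 hpQ
  have hQ' : (Q + (ΔQ : Mat n)).PosDef := posDef_add_of_norm_lt hQ ΔQ.2
    ((mul_le_mul_of_nonneg_left hΔQ (norm_nonneg _)).trans_lt hQp)
  have hε' := hε D ΔQ p hp1.le hD hΔQ
  have hτ' := hτ D p hp1.le hD
  have hσ : sigma A X D ≤ 1 / 2 := by
    rw [sigma_eq, ← hΛdef]
    refine (mul_le_mul_of_nonneg_left hτ' hΛ.le).trans ?_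
    rw [← mul_assoc]
    exact hσp.le
  have hx : ‖X' - X‖ ≤ 4 * (c₁ * p) :=
    (norm_sub_le_four_mul_eps hn hQ hX hQ' hX' hσ (he ▸ hε'.trans_lt hεp)).trans (by linarith)
  have hζx : zeta X * (4 * (c₁ * p)) ≤ 1 / 2 := by
    have := mul_le_mul_of_nonneg_left hεp.le hζ.le
    linarith
  refine (norm_sub_firstOrder_le hQ hX D ΔQ hX' hx (by linarith)).trans ?_
  rw [mul_assoc Λ, ← hΛdef]
  exact mul_le_mul_of_nonneg_left (remainder_majorant_le hζ.le hθ hc₁ hp0 (tau_nonneg A X D) hτ'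
    (fun i => norm_nonneg _) hD hζx) hΛ.le

end Asymptotics

end MatrixEq

end

theorem theorem4p4 {m n : ℕ} (A : Fin m → MatrixEq.Mat n) (Q X : MatrixEq.Mat n)
    (hQ : Q.PosDef) (hX : MatrixEq.IsPosDefSolution A Q X) :
    -- `L` is invertible
    (MatrixEq.L A X).IsInvertible ∧
    -- the perturbation bound
    (∀ (ΔA : Fin m → MatrixEq.Mat n) (ΔQ : MatrixEq.Herm n) (X' : MatrixEq.Mat n),
      (Q + (ΔQ : MatrixEq.Mat n)).PosDef →
      MatrixEq.IsPosDefSolution (fun i => A i + ΔA i) (Q + (ΔQ : MatrixEq.Mat n)) X' →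
      ∀ l ζ θ σ ε : ℝ,
        l = MatrixEq.ell A X → ζ = MatrixEq.zeta X → θ = MatrixEq.theta A X →
        σ = MatrixEq.sigma A X ΔA → ε = MatrixEq.eps A X ΔA ΔQ →
        σ < 1 →
        ε < l * (1 - σ) ^ 2 /
          (ζ * (l + l * σ + 2 * θ + 2 * √((l * σ + θ) * (θ + l)))) →
        ‖X' - X‖ ≤ MatrixEq.xi3 l ζ θ σ ε ∧
        IsLeast {ξ : ℝ | ζ * (l + θ) * ξ ^ 2 - l * (1 + ζ * ε - σ) * ξ + l * ε = 0}
          (MatrixEq.xi3 l ζ θ σ ε)) ∧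
    -- the first order bound and the first order expansion as the perturbation tends to zero
    (∃ C δ : ℝ, 0 < δ ∧
      ∀ (ΔA : Fin m → MatrixEq.Mat n) (ΔQ : MatrixEq.Herm n) (X' : MatrixEq.Mat n),
        MatrixEq.IsPosDefSolution (fun i => A i + ΔA i) (Q + (ΔQ : MatrixEq.Mat n)) X' →
        MatrixEq.pertNorm ΔA ΔQ < δ →
        ‖X' - X‖ ≤ 1 / MatrixEq.ell A X * ‖ΔQ‖ + ∑ i, ‖MatrixEq.P A X i‖ * ‖ΔA i‖
            + C * MatrixEq.pertNorm ΔA ΔQ ^ 2 ∧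
        ‖(X' - X) - ((MatrixEq.Linv A X ΔQ : MatrixEq.Herm n) : MatrixEq.Mat n)
            - ((MatrixEq.Linv A X (∑ i, MatrixEq.S A X i (ΔA i)) : MatrixEq.Herm n) :
                MatrixEq.Mat n)‖
          ≤ C * MatrixEq.pertNorm ΔA ΔQ ^ 2) := by
  refine ⟨MatrixEq.L_isInvertible hQ hX, ?_, ?_⟩
  · intro ΔA ΔQ X' hQ' hX' l ζ θ σ ε hl hζ hθ hσ hε hσ1 hlt
    have hε0 : 0 ≤ ε := hε ▸ MatrixEq.eps_nonneg A X ΔA ΔQ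
    -- If `l` or `ζ` were zero, the threshold would be `0` (for `ζ`, by the convention for division
    -- by zero), contradicting `0 ≤ ε`. The case `n = 0` is thereby vacuous here.
    have hl0 : 0 < l := by
      refine lt_of_le_of_ne (hl ▸ MatrixEq.ell_nonneg A X) fun h => ?_
      rw [← h, zero_mul, zero_div] at hlt
      linarith
    have hζ0 : 0 < ζ := by
      refine lt_of_le_of_ne (hζ ▸ MatrixEq.zeta_nonneg X) fun h => ?_
      rw [← h, zero_mul, div_zero] at hlt
      linarith
    have hσ0 : 0 ≤ σ := hσ ▸ MatrixEq.sigma_nonneg A X ΔA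
    exact ⟨MatrixEq.norm_sub_le_xi3 hQ hX ΔA ΔQ hQ' hX' hl hζ hθ hσ hε hl0 hζ0 hσ1 hlt,
      (MatrixEq.xi3_spec hl0 hζ0 (hθ ▸ MatrixEq.theta_nonneg A X) hσ0 hσ1 hε0 hlt).1⟩
  · obtain ⟨C, δ, hδ, h⟩ := MatrixEq.firstOrder_expansion hQ hX
    refine ⟨C, δ, hδ, fun ΔA ΔQ X' hX' hp => ?_⟩
    have hexp := h ΔA ΔQ X' hX' hp
    exact ⟨MatrixEq.norm_sub_le_of_expansion A X X' ΔA ΔQ hexp, hexp⟩
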